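/- Digraphs are finite, without loops and without multiple arcs (arcs in both directions between two vertices are allowed), and paths are directed and do not repeat vertices; the length of a path is its number of arcs. Let $k$ be a positive integer. A digraph is $m$-strong if it has at least $m+1$ vertices and, after deleting any set of at most $m-1$ vertices, there is a path from $x$ to $y$ for every ordered pair of distinct remaining vertices $x,y$. It is $l$-quasi-transitive if, for all vertices $u,v$ such that there is a path of length $l$ from $u$ to $v$, there is at least one arc between $u$ and $v$ (that is, $uv$ or $vu$ is an arc). It is $k$-linked if it has at least $2k$ vertices and for any $2k$ distinct vertices $x_1,\dots,x_k,y_1,\dots,y_k$ there are pairwise vertex-disjoint paths $P_1,\dots,P_k$ such that $P_i$ starts at $x_i$ and ends at $y_i$ for each $i\in\{1,\dots,k\}$. Theorem. Let $l\ge 2$ and $k\ge 1$ be integers. Every $81k^2(l+2)^2$-strong $l$-quasi-transitive digraph is $k$-linked. -/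

import Mathlib

/-- `D.IsPathFromTo x y p`: the list `p` is the vertex sequence of a directed path of `D`
(no repeated vertex) whose initial vertex is `x` and whose terminal vertex is `y`. -/
def Digraph.IsPathFromTo {V : Type*} (D : Digraph V) (x y : V) (p : List V) : Prop :=
  p.IsChain D.Adj ∧ p.Nodup ∧ p.head? = some x ∧ p.getLast? = some y

/-- `D` is `m`-strong: it has at least `m + 1` vertices and, after deleting any set `S` of at most
`m - 1` vertices, there is a path from `x` to `y` for any two distinct remaining vertices.
(A path of the digraph with `S` deleted is a path of `D` that has no vertex in `S`.) -/
def Digraph.IsStrong {V : Type*} [Fintype V] (D : Digraph V) (m : ℕ) : Prop :=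
  m + 1 ≤ Fintype.card V ∧
    ∀ S : Finset V, S.card < m → ∀ x y : V, x ∉ S → y ∉ S → x ≠ y →
      ∃ p : List V, D.IsPathFromTo x y p ∧ ∀ v ∈ p, v ∉ S

/-- `D` is `l`-quasi-transitive: whenever there is a path of length `l` (that is, with `l` arcs,
hence `l + 1` vertices) from `u` to `v`, there is at least one arc between `u` and `v`. -/
def Digraph.IsQuasiTransitive {V : Type*} (D : Digraph V) (l : ℕ) : Prop :=
  ∀ u v : V, (∃ p : List V, D.IsPathFromTo u v p ∧ p.length = l + 1) → D.Adj u v ∨ D.Adj v u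

/-- `D` is `k`-linked: it has at least `2k` vertices and, for any `2k` distinct vertices
`x₁, …, x_k, y₁, …, y_k`, there are pairwise vertex-disjoint paths `P₁, …, P_k` such that
`P_i` goes from `x_i` to `y_i`. -/
def Digraph.IsLinked {V : Type*} [Fintype V] (D : Digraph V) (k : ℕ) : Prop :=
  2 * k ≤ Fintype.card V ∧
    ∀ x y : Fin k → V, Function.Injective x → Function.Injective y → (∀ i j, x i ≠ y j) →
      ∃ P : Fin k → List V, (∀ i, D.IsPathFromTo (x i) (y i) (P i)) ∧
        ∀ i j, i ≠ j → (P i).Disjoint (P j)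

/-! Among the non-terminal vertices, take a set `B` of `k` vertices of least in-degree. Each `b ∈ B`
roots a fan of short paths to all the `y i`, and different fans meet only in the `y i`. Menger's
theorem then gives disjoint paths from the `x i` to `B` avoiding the `y i` and the fans, roots
excepted. Which root `x i` reaches is irrelevant, since every fan contains a path to `y i`.

Fans are small by `IsStrong.exists_short_path`. Let `c` have least in-degree outside `S`. Vertices
at distance exactly `l` from `c` in `D - S` dominate `c`. If some vertex were at distance more than
`l + 2`, there would be a far vertex `y` whose in-neighbours outside `S` all dominate `c`. Level `l`
together with `S` separates `c` from `y`, so that level has more than `|S|` vertices, and `c` would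
have larger in-degree than `y`. -/

namespace Digraph

/-! ### Directed paths. -/

variable {V : Type*}

/-- The path traced by an injective sequence of consecutively adjacent vertices. -/
theorem isPathFromTo_map_range {D : Digraph V} {p : ℕ → V} {n : ℕ}
    (hadj : ∀ i < n, D.Adj (p i) (p (i + 1)))
    (hinj : ∀ i ≤ n, ∀ j ≤ n, p i = p j → i = j) :
    D.IsPathFromTo (p 0) (p n) ((List.range (n + 1)).map p) := by
  refine ⟨?_, ?_, ?_, ?_⟩
  · rw [List.isChain_iff_getElem]
    intro i hi
    simp only [List.length_map, List.length_range] at hi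
    simpa using hadj i (by omega)
  · refine List.Nodup.map_on ?_ List.nodup_range
    intro i hi j hj h
    rw [List.mem_range] at hi hj
    exact hinj i (by omega) j (by omega) h
  · simp [List.range_succ_eq_map]
  · simp [List.range_succ]

theorem IsQuasiTransitive.adj_or_adj {D : Digraph V} {l : ℕ} (h : D.IsQuasiTransitive l)
    {p : ℕ → V} (hadj : ∀ i < l, D.Adj (p i) (p (i + 1)))
    (hinj : ∀ i ≤ l, ∀ j ≤ l, p i = p j → i = j) :
    D.Adj (p 0) (p l) ∨ D.Adj (p l) (p 0) :=
  h _ _ ⟨_, isPathFromTo_map_range hadj hinj, by simp⟩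

/-- A path that ends where another one begins, and meets it nowhere else, extends it. -/
theorem IsPathFromTo.append {D : Digraph V} {x b y : V} {p t : List V}
    (hp : D.IsPathFromTo x b p) (ht : D.IsPathFromTo b y (b :: t)) (hd : p.Disjoint t) :
    D.IsPathFromTo x y (p ++ t) := by
  obtain ⟨hc, hn, hh, hl⟩ := hp
  obtain ⟨hc', hn', -, hl'⟩ := ht
  refine ⟨?_, ?_, ?_, ?_⟩
  · rw [List.isChain_append]
    rw [List.isChain_cons] at hc'
    refine ⟨hc, hc'.2, ?_⟩
    intro u hu v hv
    rw [hl, Option.mem_some_iff] at hu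
    exact hu ▸ hc'.1 v hv
  · exact hn.append (List.nodup_cons.1 hn').2 hd
  · simp [List.head?_append, hh]
  · cases t with
    | nil => simpa using hl.trans (by simpa using hl')
    | cons a t => simpa [List.getLast?_append, List.getLast?_cons_cons] using hl'

/-- A property that propagates along arcs is inherited by the end of a path. -/
theorem IsPathFromTo.induction {D : Digraph V} {P : V → Prop} {T : Set V}
    (hP : ∀ v w, P v → D.Adj v w → w ∉ T → P w) {p : List V} :
    ∀ {x y : V}, D.IsPathFromTo x y p → (∀ v ∈ p, v ∉ T) → P x → P y := by
  induction p with
  | nil => intro x y h; simp [IsPathFromTo] at h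
  | cons a p ih =>
    rintro x y ⟨hc, hn, hh, hl⟩ hT hx
    obtain rfl : a = x := by simpa using hh
    cases p with
    | nil =>
      obtain rfl : a = y := by simpa using hl
      exact hx
    | cons b p =>
      rw [List.isChain_cons_cons] at hc
      refine ih (x := b) ⟨hc.2, (List.nodup_cons.1 hn).2, by simp, ?_⟩
        (fun v hv => hT v (List.mem_cons_of_mem _ hv)) (hP _ _ hx hc.1 (hT b (by simp)))
      simpa [List.getLast?_cons_cons] using hl

/-! ### Strong digraphs and distances. -/

section Strong

variable [Fintype V] {D : Digraph V} {m : ℕ}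

/-- Separation form of strongness: a set of fewer than `m` vertices cannot cut `x` off from `y`. -/
theorem IsStrong.induction (h : D.IsStrong m) {T : Finset V} (hT : T.card < m) {P : V → Prop}
    (hP : ∀ v w, P v → D.Adj v w → w ∉ T → P w) {x y : V} (hx : x ∉ T) (hy : y ∉ T)
    (hPx : P x) : P y := by
  by_cases hxy : x = y
  · exact hxy ▸ hPx
  · obtain ⟨p, hp, hpT⟩ := h.2 T hT x y hx hy hxy
    exact hp.induction (T := (T : Set V)) (by simpa using hP) (by simpa using hpT) hPx

/-- Start outside `T ∪ {y}` and delete `T` without `y`: some path enters `y` from outside `T`. The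
vertex `y` may itself lie in `T`. -/
theorem IsStrong.exists_adj_notMem (h : D.IsStrong m) {T : Finset V} (hT : T.card < m) (y : V) :
    ∃ w, w ∉ T ∧ D.Adj w y := by
  classical
  by_contra! hno
  have hcard : (insert y T).card < (Finset.univ : Finset V).card := by
    have := Finset.card_insert_le y T
    have := h.1
    rw [Finset.card_univ]
    omega
  obtain ⟨z, -, hz⟩ := Finset.exists_mem_notMem_of_card_lt_card hcard
  rw [Finset.mem_insert, not_or] at hz
  have := h.induction (T := T.erase y) ((Finset.card_erase_le).trans_lt hT)
    (P := fun v => v ≠ y ∧ v ∉ T)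
    (by
      rintro v w ⟨hv, hvT⟩ hvw hw
      have hwy : w ≠ y := by
        rintro rfl
        exact hno v hvT hvw
      exact ⟨hwy, fun h' => hw (Finset.mem_erase.2 ⟨hwy, h'⟩)⟩)
    (x := z) (y := y) (fun h' => hz.2 (Finset.mem_of_mem_erase h')) (by simp) hz
  exact this.1 rfl

/-- Distances from `c` in the strong digraph obtained by deleting `S`. -/
theorem IsStrong.exists_dist (h : D.IsStrong m) {S : Finset V} (hS : S.card < m) {c : V}
    (hc : c ∉ S) :
    ∃ d : V → ℕ, d c = 0 ∧ (∀ v w, v ∉ S → w ∉ S → D.Adj v w → d w ≤ d v + 1) ∧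
      ∀ n w, w ∉ S → d w = n → ∃ u : ℕ → V, u 0 = c ∧ u n = w ∧ (∀ i ≤ n, u i ∉ S) ∧
        (∀ i ≤ n, d (u i) = i) ∧ ∀ i < n, D.Adj (u i) (u (i + 1)) := by
  classical
  -- `R n v`: a walk of length `n` from `c` to `v` avoids `S`. On `S` the infimum `d` below takes
  -- the default value `0`, so only its values outside `S` are meaningful.
  let R : ℕ → V → Prop := fun n => Nat.rec (fun v => v = c)
    (fun _ r w => w ∉ S ∧ ∃ v, r v ∧ D.Adj v w) n
  have hRS : ∀ n v, R n v → v ∉ S := by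
    intro n v hv
    cases n with
    | zero =>
      have hv' : v = c := hv
      exact hv' ▸ hc
    | succ n => exact hv.1
  have hR : ∀ v, v ∉ S → ∃ n, R n v := fun v hv =>
    h.induction hS (P := fun v => ∃ n, R n v)
      (fun v w ⟨n, hn⟩ hvw hw => ⟨n + 1, hw, v, hn, hvw⟩) hc hv ⟨0, rfl⟩
  let d : V → ℕ := fun v => sInf {n | R n v}
  have hd : ∀ v, v ∉ S → R (d v) v := fun v hv => Nat.sInf_mem (hR v hv)
  have hle : ∀ n v, R n v → d v ≤ n := fun n v hv => Nat.sInf_le hv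
  have hstep : ∀ v w, v ∉ S → w ∉ S → D.Adj v w → d w ≤ d v + 1 := fun v w hv hw hvw =>
    hle _ _ ⟨hw, v, hd v hv, hvw⟩
  refine ⟨d, Nat.le_zero.1 (hle 0 c rfl), hstep, ?_⟩
  intro n
  induction n with
  | zero =>
    intro w hw h0
    have hwc : w = c := by
      have := hd w hw
      rw [h0] at this
      exact this
    subst hwc
    exact ⟨fun _ => w, rfl, rfl, fun _ _ => hw, fun i hi => by
      obtain rfl : i = 0 := by omega
      exact h0, fun i hi => by omega⟩
  | succ n ih =>
    intro w hw hn
    have hRw := hd w hw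
    rw [hn] at hRw
    obtain ⟨-, v, hv, hvw⟩ := hRw
    have hvS := hRS n v hv
    have hdv : d v = n := by
      have := hle n v hv
      have := hstep v w hvS hw hvw
      omega
    obtain ⟨u, hu0, hun, huS, hud, hua⟩ := ih v hvS hdv
    refine ⟨fun i => if i ≤ n then u i else w, by simp [hu0], by simp, ?_, ?_, ?_⟩
    · intro i hi
      by_cases hin : i ≤ n
      · simpa [hin] using huS i hin
      · simpa [hin] using hw
    · intro i hi
      by_cases hin : i ≤ n
      · simpa [hin] using hud i hin
      · simp only [hin, if_false]
        omega
    · intro i hi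
      by_cases hin : i + 1 ≤ n
      · simpa [hin, show i ≤ n by omega] using hua i hin
      · obtain rfl : i = n := by omega
        simpa [hun] using hvw

/-! ### Short paths from a vertex of least in-degree. -/

open Classical in
/-- In a highly strong `l`-quasi-transitive digraph, a vertex whose in-degree is least among the
vertices outside a small set `S` reaches every such vertex by a short path avoiding `S`. -/
theorem IsStrong.exists_short_path (h : D.IsStrong m) (hloop : ∀ v, ¬ D.Adj v v) {l : ℕ}
    (hl : 2 ≤ l) (hqt : D.IsQuasiTransitive l) {S : Finset V} (hS : 2 * S.card < m) {c : V}
    (hc : c ∉ S)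
    (hmin : ∀ v, v ∉ S → (Finset.univ.filter (D.Adj · c)).card ≤
      (Finset.univ.filter (D.Adj · v)).card) {v : V} (hv : v ∉ S) :
    ∃ p : List V, D.IsPathFromTo c v p ∧ (∀ w ∈ p, w ∉ S) ∧ p.length ≤ l + 3 := by
  obtain ⟨d, hdc, hstep, hpath⟩ := h.exists_dist (by omega) hc
  have hback : ∀ w, w ∉ S → d w = l → D.Adj w c := by
    intro w hw hdw
    obtain ⟨u, hu0, hun, huS, hud, hua⟩ := hpath l w hw hdw
    have := hqt.adj_or_adj hua (fun i hi j hj hij => by rw [← hud i hi, hij, hud j hj])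
    rw [hu0, hun] at this
    refine this.resolve_left fun h' => ?_
    have := hstep c w hc hw h'
    omega
  -- no vertex is both far away and dominated only by in-neighbours of `c`
  have key : ∀ y, y ∉ S → l + 2 ≤ d y → ¬ ∀ w, w ∉ S → D.Adj w y → D.Adj w c := by
    intro y hy hdy hall
    let L : Finset V := Finset.univ.filter fun w => w ∉ S ∧ d w = l
    -- Distance grows by at most one along an arc, so no path from `c` to `y` can skip level `l`.
    have hL : m ≤ L.card + S.card := by
      by_contra! hlt
      have hcard : (L ∪ S).card < m := (Finset.card_union_le _ _).trans_lt hlt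
      have := h.induction hcard (P := fun v => v ∉ S ∧ d v < l)
        (by
          rintro v w ⟨hvS, hvl⟩ hvw hw
          simp only [L, Finset.mem_union, Finset.mem_filter, Finset.mem_univ, true_and,
            not_or, not_and] at hw
          have h1 := hstep v w hvS hw.2 hvw
          have h2 := hw.1 hw.2
          exact ⟨hw.2, by omega⟩) (x := c) (y := y)
        (by simp [L, hc, hdc]; omega) (by simp [L, hy]; omega) ⟨hc, by omega⟩
      omega
    have hsub : L ∪ (Finset.univ.filter (D.Adj · y) \ S) ⊆ Finset.univ.filter (D.Adj · c) := by
      intro w hw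
      simp only [L, Finset.mem_union, Finset.mem_sdiff, Finset.mem_filter, Finset.mem_univ,
        true_and] at hw ⊢
      rcases hw with hw | hw
      · exact hback w hw.1 hw.2
      · exact hall w hw.2 hw.1
    have hdisj : Disjoint L (Finset.univ.filter (D.Adj · y) \ S) := by
      rw [Finset.disjoint_left]
      intro w hw hw'
      simp only [L, Finset.mem_sdiff, Finset.mem_filter, Finset.mem_univ, true_and] at hw hw'
      have := hstep w y hw.1 hy hw'.1
      omega
    -- The in-degree of `c` is at least `|L|` plus that of `y` minus `|S|`, and `|L| ≥ m - |S| >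
    -- |S|`.
    have h1 := Finset.card_le_card hsub
    rw [Finset.card_union_of_disjoint hdisj] at h1
    have h2 := Finset.le_card_sdiff S (Finset.univ.filter (D.Adj · y))
    have h3 := hmin y hy
    omega
  have hdv : d v ≤ l + 2 := by
    by_contra! hfar
    obtain ⟨u, hu0, hun, huS, hud, hua⟩ := hpath (d v) v hv rfl
    have huq : ∀ a, a + l ≤ d v → D.Adj (u (a + l)) (u a) := by
      intro a ha
      have := hqt.adj_or_adj (p := fun i => u (a + i)) (fun i hi => hua _ (by omega))
        (fun i hi j hj hij => by
          have := hud (a + i) (by omega)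
          rw [hij, hud _ (by omega)] at this
          omega)
      refine this.resolve_left fun h' => ?_
      have := hstep _ _ (huS _ (by omega)) (huS _ (by omega)) h'
      rw [hud _ (by omega), hud _ (by omega)] at this
      omega
    -- a path of length `l` from a far vertex to `c` ends with an arc to `c`
    have hfar_adj : ∀ w, w ∉ S → 2 ≤ d w → D.Adj w c ∨ D.Adj c w → D.Adj w c := by
      intro w hw hdw h'
      refine h'.resolve_right fun h'' => ?_
      have := hstep c w hc hw h''
      omega
    rcases hl.eq_or_lt with rfl | hl3
    -- For `l = 2` the path used below has no room for `u 3`; here `u 4 → u 2 → u 0` gives `u 4 →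
    -- c`, and then `w → u 4 → c` applies to every in-neighbour `w`.
    · have h4 : D.Adj (u 4) c := by
        refine hfar_adj _ (huS _ (by omega)) (by rw [hud _ (by omega)]; omega) ?_
        have h42 := huq 2 (by omega)
        have h20 := huq 0 (by omega)
        have := hqt.adj_or_adj (p := fun i => u (4 - 2 * i))
          (fun i hi => by
            interval_cases i
            · exact h42
            · exact h20)
          (fun i hi j hj hij => by
            have := hud (4 - 2 * i) (by omega)
            rw [hij, hud _ (by omega)] at this
            omega)
        simpa [hu0] using this
      refine key (u 4) (huS _ (by omega)) (by rw [hud _ (by omega)]) fun w hw hwu => ?_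
      have hdw := hstep w _ hw (huS _ (by omega)) hwu
      rw [hud _ (by omega)] at hdw
      refine hfar_adj w hw (by omega) ?_
      refine hqt w c ⟨[w, u 4, c], ⟨by simp [hwu, h4], ?_, by simp, by simp⟩, by simp⟩
      have h1 : w ≠ u 4 := by
        intro h'
        exact hloop _ (h' ▸ hwu)
      have h2 : w ≠ c := by
        rintro rfl
        omega
      have h3 : u 4 ≠ c := by
        intro h'
        have := hud 4 (by omega)
        rw [h', hdc] at this
        omega
      simp [h1, h2, h3]
    · have hd3 : d (u (l + 3)) = l + 3 := hud _ (by omega)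
      refine key (u (l + 3)) (huS _ (by omega)) (by omega) fun w hw hwu => ?_
      have hdw := hstep w _ hw (huS _ (by omega)) hwu
      refine hfar_adj w hw (by omega) ?_
      have hwy : w ≠ u (l + 3) := by
        intro h'
        exact hloop _ (h' ▸ hwu)
      -- The path `w, u (l + 3), u 3, u 4, …, u l, c` has length `l`: it jumps back by `l`, climbs
      -- to level `l`, and then jumps to `c`.
      let p : ℕ → V := fun i =>
        if i = 0 then w else if i = 1 then u (l + 3) else if i = l then c else u (i + 1)
      have hp0 : p 0 = w := rfl
      have hp1 : p 1 = u (l + 3) := rfl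
      have hpl : p l = c := by
        simp [p, show l ≠ 0 by omega, show l ≠ 1 by omega]
      have hpi : ∀ i, 2 ≤ i → i < l → p i = u (i + 1) := by
        intro i h1 h2
        simp only [p]
        rw [if_neg (by omega), if_neg (by omega), if_neg (by omega)]
      have hdi : ∀ i, 2 ≤ i → i ≤ l → d (p i) = if i = l then 0 else i + 1 := by
        intro i h1 h2
        by_cases hil : i = l
        · rw [if_pos hil, hil, hpl, hdc]
        · rw [if_neg hil, hpi i h1 (by omega), hud _ (by omega)]
      have := hqt.adj_or_adj (p := p)
        (by
          intro i hi
          rcases Nat.lt_or_ge i 2 with hi2 | hi2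
          · interval_cases i
            · exact hwu
            · rw [hp1, hpi 2 le_rfl (by omega), show l + 3 = 3 + l by omega]
              exact huq 3 (by omega)
          · rw [hpi i hi2 hi]
            rcases Nat.lt_or_ge (i + 1) l with hil | hil
            · rw [hpi (i + 1) (by omega) hil]
              exact hua _ (by omega)
            · rw [show i + 1 = l by omega, hpl, ← hu0]
              simpa using huq 0 (by omega))
        (by
          have hlt : ∀ i ≤ l, ∀ j ≤ l, i < j → p i ≠ p j := by
            intro i hi j hj hij heq
            rcases Nat.lt_or_ge j 2 with hj2 | hj2
            · obtain rfl : i = 0 := by omega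
              obtain rfl : j = 1 := by omega
              exact hwy heq
            · have hj' := hdi j hj2 hj
              rcases Nat.lt_or_ge i 2 with hi2 | hi2
              · have hbig : l + 2 ≤ d (p i) := by
                  interval_cases i
                  · rw [hp0]
                    omega
                  · rw [hp1]
                    omega
                rw [heq, hj'] at hbig
                split_ifs at hbig <;> omega
              · have hi' := hdi i hi2 hi
                rw [heq, hj'] at hi'
                split_ifs at hi' <;> omega
          intro i hi j hj hij
          rcases lt_trichotomy i j with h' | h' | h'
          · exact absurd hij (hlt i hi j hj h')
          · exact h'
          · exact absurd hij.symm (hlt j hj i hi h'))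
      rwa [hp0, hpl] at this
  obtain ⟨u, hu0, hun, huS, hud, hua⟩ := hpath (d v) v hv rfl
  refine ⟨(List.range (d v + 1)).map u, ?_, ?_, by simp; omega⟩
  · have := isPathFromTo_map_range hua (fun i hi j hj hij => by rw [← hud i hi, hij, hud j hj])
    rwa [hu0, hun] at this
  · intro w hw
    obtain ⟨i, hi, rfl⟩ := List.mem_map.1 hw
    exact huS i (by rw [List.mem_range] at hi; omega)

/-! ### Menger's theorem from Hall's theorem. -/

/-- The Menger property of a strong digraph: two sets of equal size are joined by disjoint paths
avoiding a given small set. -/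
theorem IsStrong.exists_linkage (h : D.IsStrong m) {A B Z : Finset V} (hAB : A.card = B.card)
    (hAZ : Disjoint A Z) (hBZ : Disjoint B Z) (hcard : Z.card + A.card ≤ m) :
    ∃ (g : V → V) (P : V → List V), (∀ a ∈ A, g a ∈ B ∧ D.IsPathFromTo a (g a) (P a) ∧
      ∀ v ∈ P a, v ∉ Z) ∧ ∀ a ∈ A, ∀ a' ∈ A, a ≠ a' → (P a).Disjoint (P a') := by
  classical
  -- Distinct representatives form an injective successor map that never enters `A`; a vertex may
  -- represent itself, which means that it is unused.
  let t : {v // v ∉ Z ∧ v ∉ B} → Finset V := fun v =>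
    Finset.univ.filter fun w => w ∉ Z ∧ w ∉ A ∧ (w = v ∨ D.Adj v w)
  have hall : ∀ s : Finset {v // v ∉ Z ∧ v ∉ B}, s.card ≤ (s.biUnion t).card := by
    intro s
    by_contra! hlt
    set N := s.biUnion t with hN
    let W : Finset V := s.image Subtype.val
    have hWcard : W.card = s.card := Finset.card_image_of_injective _ Subtype.val_injective
    have hmemW : ∀ v ∈ W, v ∉ Z ∧ v ∉ B := by
      intro v hv
      obtain ⟨v, -, rfl⟩ := Finset.mem_image.1 hv
      exact v.2
    have hmemN : ∀ w v, v ∈ W → w ∉ Z → w ∉ A → (w = v ∨ D.Adj v w) → w ∈ N := by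
      intro w v hv hwZ hwA hvw
      obtain ⟨v, hvs, rfl⟩ := Finset.mem_image.1 hv
      exact Finset.mem_biUnion.2 ⟨v, hvs, by simp [t, hwZ, hwA, hvw]⟩
    have hsub : W \ A ⊆ N := by
      intro w hw
      rw [Finset.mem_sdiff] at hw
      exact hmemN w w hw.1 (hmemW w hw.1).1 hw.2 (Or.inl rfl)
    -- A Hall violator `W` yields a separator: arcs leaving `W` outside `Z` end in `T`, and `|T| ≤
    -- |N| - |W| + |A| < |A|`.
    let T := (N \ W) ∪ (A \ W)
    have hT : T.card < A.card := by
      have h1 : T.card ≤ (N \ W).card + (A \ W).card := Finset.card_union_le _ _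
      have h2 : (N \ W).card ≤ (N \ (W \ A)).card :=
        Finset.card_le_card (Finset.sdiff_subset_sdiff le_rfl Finset.sdiff_subset)
      have h3 := Finset.card_sdiff_add_card_eq_card hsub
      have h4 := Finset.card_sdiff_add_card_inter W A
      have h5 := Finset.card_sdiff_add_card_inter A W
      rw [Finset.inter_comm] at h5
      omega
    obtain ⟨a, haA, haT⟩ := Finset.exists_mem_notMem_of_card_lt_card hT
    obtain ⟨b, hbB, hbT⟩ := Finset.exists_mem_notMem_of_card_lt_card (hAB ▸ hT)
    have haW : a ∈ W := by
      by_contra hW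
      exact haT (Finset.mem_union_right _ (Finset.mem_sdiff.2 ⟨haA, hW⟩))
    have haZ := Finset.disjoint_left.1 hAZ haA
    have hbZ := Finset.disjoint_left.1 hBZ hbB
    have hbW : b ∈ W := h.induction (T := T ∪ Z) (P := fun v => v ∈ W)
      (by have := Finset.card_union_le T Z; omega)
      (by
        intro v w hv hvw hw
        rw [Finset.mem_union, not_or] at hw
        by_contra hwW
        apply hw.1
        by_cases hwA : w ∈ A
        · exact Finset.mem_union_right _ (Finset.mem_sdiff.2 ⟨hwA, hwW⟩)
        · exact Finset.mem_union_left _ (Finset.mem_sdiff.2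
            ⟨hmemN w v hv hw.2 hwA (Or.inr hvw), hwW⟩))
      (x := a) (by simp [haT, haZ]) (by simp [hbT, hbZ]) haW
    exact (hmemW b hbW).2 hbB
  obtain ⟨f, hf, hft⟩ := (Finset.all_card_le_biUnion_card_iff_exists_injective t).1 hall
  let F : V → V := fun v => if hv : v ∉ Z ∧ v ∉ B then f ⟨v, hv⟩ else v
  have hF : ∀ v, v ∉ Z → v ∉ B → F v ∉ Z ∧ F v ∉ A ∧ (F v = v ∨ D.Adj v (F v)) := by
    intro v hZ hB
    have := hft ⟨v, hZ, hB⟩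
    simp only [F, hZ, hB, not_false_eq_true, and_self, dite_true]
    simpa [t] using this
  have hFinj : ∀ v w, v ∉ Z → v ∉ B → w ∉ Z → w ∉ B → F v = F w → v = w := by
    intro v w hv hv' hw hw' hvw
    simp only [F, hv, hv', hw, hw', not_false_eq_true, and_self, dite_true] at hvw
    simpa using hf hvw
  have hZ : ∀ a ∈ A, ∀ n, (∀ i < n, F^[i] a ∉ B) → F^[n] a ∉ Z := by
    intro a ha n
    induction n with
    | zero => intro _; exact Finset.disjoint_left.1 hAZ ha
    | succ n ih =>
      intro hn
      rw [Function.iterate_succ_apply']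
      exact (hF _ (ih fun i hi => hn i (by omega)) (hn n (by omega))).1
  -- Backtrack by injectivity until one orbit is at its start in `A`; as `F` has no value in `A`, so
  -- is the other. Hence orbits neither cycle nor meet, and by finiteness they reach `B`.
  have hcancel : ∀ a ∈ A, ∀ a' ∈ A, ∀ i j, (∀ r < i, F^[r] a ∉ B) → (∀ r < j, F^[r] a' ∉ B) →
      F^[i] a = F^[j] a' → i = j ∧ a = a' := by
    intro a ha a' ha' i
    induction i with
    | zero =>
      intro j hi hj hij
      cases j with
      | zero => exact ⟨rfl, hij⟩
      | succ j =>
        rw [Function.iterate_succ_apply'] at hij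
        have := (hF _ (hZ a' ha' j fun r hr => hj r (by omega)) (hj j (by omega))).2.1
        rw [← hij] at this
        exact absurd ha this
    | succ i ih =>
      intro j hi hj hij
      cases j with
      | zero =>
        rw [Function.iterate_succ_apply'] at hij
        have := (hF _ (hZ a ha i fun r hr => hi r (by omega)) (hi i (by omega))).2.1
        rw [hij] at this
        exact absurd ha' this
      | succ j =>
        rw [Function.iterate_succ_apply', Function.iterate_succ_apply'] at hij
        have := ih j (fun r hr => hi r (by omega)) (fun r hr => hj r (by omega))
          (hFinj _ _ (hZ a ha i fun r hr => hi r (by omega)) (hi i (by omega))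
            (hZ a' ha' j fun r hr => hj r (by omega)) (hj j (by omega)) hij)
        exact ⟨by omega, this.2⟩
  have hreach : ∀ a ∈ A, ∃ n, F^[n] a ∈ B := by
    intro a ha
    by_contra! hno
    refine not_injective_infinite_finite (fun n => F^[n] a) fun i j hij => ?_
    exact (hcancel a ha a ha i j (fun r _ => hno r) (fun r _ => hno r) hij).1
  let n : V → ℕ := fun a => sInf {n | F^[n] a ∈ B}
  have hnB : ∀ a ∈ A, F^[n a] a ∈ B := fun a ha => Nat.sInf_mem (hreach a ha)
  have hnlt : ∀ a, ∀ i < n a, F^[i] a ∉ B := fun a i hi => Nat.notMem_of_lt_sInf hi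
  refine ⟨fun a => F^[n a] a, fun a => (List.range (n a + 1)).map fun i => F^[i] a, ?_, ?_⟩
  · intro a ha
    have hinj : ∀ i ≤ n a, ∀ j ≤ n a, F^[i] a = F^[j] a → i = j := fun i hi j hj hij =>
      (hcancel a ha a ha i j (fun r hr => hnlt a r (by omega)) (fun r hr => hnlt a r (by omega))
        hij).1
    refine ⟨hnB a ha, isPathFromTo_map_range (p := fun i => F^[i] a) ?_ hinj, ?_⟩
    · intro i hi
      have hne : F^[i + 1] a ≠ F^[i] a := fun h' => by
        have := hinj (i + 1) hi i hi.le h'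
        omega
      have := (hF _ (hZ a ha i fun r hr => hnlt a r (by omega)) (hnlt a i hi)).2.2
      rw [← Function.iterate_succ_apply' F i a] at this
      exact this.resolve_left hne
    · intro v hv
      obtain ⟨i, hi, rfl⟩ := List.mem_map.1 hv
      rw [List.mem_range] at hi
      exact hZ a ha i fun r hr => hnlt a r (by omega)
  · intro a ha a' ha' hne v hv hv'
    obtain ⟨i, hi, rfl⟩ := List.mem_map.1 hv
    obtain ⟨j, hj, hij⟩ := List.mem_map.1 hv'
    rw [List.mem_range] at hi hj
    exact hne (hcancel a ha a' ha' i j (fun r hr => hnlt a r (by omega))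
      (fun r hr => hnlt a' r (by omega)) hij.symm).2

/-! ### Disjoint fans. -/

open Classical in
/-- Short paths from one vertex of small in-degree to all the prescribed terminal vertices. -/
theorem IsStrong.exists_fan (h : D.IsStrong m) (hloop : ∀ v, ¬ D.Adj v v) {l k : ℕ}
    (hl : 2 ≤ l) (hqt : D.IsQuasiTransitive l) {S : Finset V} (hS : 2 * S.card < m) {c : V}
    (hc : c ∉ S)
    (hmin : ∀ v, v ∉ S → (Finset.univ.filter (D.Adj · c)).card ≤
      (Finset.univ.filter (D.Adj · v)).card) {y : Fin k → V} (hy : ∀ i, y i ∈ S) :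
    ∃ I : Finset V, c ∈ I ∧ Disjoint I S ∧ I.card ≤ k * (l + 3) + 1 ∧
      ∀ i, ∃ p, D.IsPathFromTo c (y i) (c :: p) ∧ ∀ v ∈ p, v ∈ I ∨ v = y i := by
  have hw : ∀ i, ∃ w, w ∉ S ∧ D.Adj w (y i) := fun i => h.exists_adj_notMem (by omega) (y i)
  choose w hwS hwy using hw
  choose p hp hpS hpl using fun i => h.exists_short_path hloop hl hqt hS hc hmin (hwS i)
  refine ⟨insert c (Finset.univ.biUnion fun i => (p i).toFinset), Finset.mem_insert_self _ _,
    ?_, ?_, ?_⟩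
  · rw [Finset.disjoint_left]
    intro v hv
    rw [Finset.mem_insert, Finset.mem_biUnion] at hv
    rcases hv with rfl | ⟨i, -, hi⟩
    · exact hc
    · exact hpS i v (List.mem_toFinset.1 hi)
  · refine (Finset.card_insert_le _ _).trans (Nat.succ_le_succ ?_)
    refine (Finset.card_biUnion_le_card_mul _ _ (l + 3) fun i _ => ?_).trans (by simp)
    exact (List.toFinset_card_le _).trans (hpl i)
  · intro i
    have hne : w i ≠ y i := fun h' => hwS i (h' ▸ hy i)
    have happ := (hp i).append (t := [y i]) (y := y i)
      ⟨by simp [hwy i], by simp [hne], by simp, by simp⟩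
      (by simpa using fun h' => hpS i _ h' (hy i))
    have hhead := (hp i).2.2.1
    cases hq : p i with
    | nil => simp [hq] at hhead
    | cons a q =>
      obtain rfl : a = c := by simpa [hq] using hhead
      rw [hq, List.cons_append] at happ
      refine ⟨q ++ [y i], happ, fun v hv => ?_⟩
      rw [List.mem_append, List.mem_singleton] at hv
      refine hv.imp_left fun hv => Finset.mem_insert_of_mem (Finset.mem_biUnion.2
        ⟨i, Finset.mem_univ _, by simp [hq, hv]⟩)

end Strong

end Digraph

/-- Remove a minimiser of `f` repeatedly. -/
theorem Finset.exists_subset_card_eq_of_least {α : Type*} [DecidableEq α] (f : α → ℕ)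
    (U : Finset α) {k : ℕ} (hk : k ≤ U.card) :
    ∃ B ⊆ U, B.card = k ∧ ∀ b ∈ B, ∀ v ∈ U \ B, f b ≤ f v := by
  induction k with
  | zero => exact ⟨∅, by simp, rfl, by simp⟩
  | succ k ih =>
    obtain ⟨B, hBU, hBk, hB⟩ := ih (by omega)
    have hne : (U \ B).Nonempty := by
      rw [← Finset.card_pos, Finset.card_sdiff_of_subset hBU]
      omega
    obtain ⟨c, hc, hmin⟩ := Finset.exists_min_image (U \ B) f hne
    have hc' := Finset.mem_sdiff.1 hc
    refine ⟨insert c B, Finset.insert_subset hc'.1 hBU, ?_, ?_⟩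
    · rw [Finset.card_insert_of_notMem hc'.2, hBk]
    · intro b hb v hv
      have hv' : v ∈ U \ B := by
        simp only [Finset.mem_sdiff, Finset.mem_insert, not_or] at hv ⊢
        exact ⟨hv.1, hv.2.2⟩
      rcases Finset.mem_insert.1 hb with rfl | hb
      · exact hmin v hv'
      · exact hB b hb v hv'

open Classical in
/-- Pairwise disjoint fans from the vertices of `B` to all the prescribed terminal vertices. -/
theorem Digraph.IsStrong.exists_fans {V : Type*} [Fintype V] {D : Digraph V} {m : ℕ}
    (h : D.IsStrong m) (hloop : ∀ v, ¬ D.Adj v v) {l k : ℕ}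
    (hl : 2 ≤ l) (hqt : D.IsQuasiTransitive l) {B U : Finset V} (hBU : Disjoint B U)
    (hmin : ∀ b ∈ B, ∀ v, v ∉ B → v ∉ U → (Finset.univ.filter (D.Adj · b)).card ≤
      (Finset.univ.filter (D.Adj · v)).card) {y : Fin k → V} (hy : ∀ i, y i ∈ U)
    (hm : 2 * (U.card + B.card + B.card * (k * (l + 3) + 1)) < m) {J : Finset V} (hJ : J ⊆ B) :
    ∃ I : V → Finset V, (∀ b ∈ J, b ∈ I b ∧ Disjoint (I b) (U ∪ B.erase b) ∧
      (I b).card ≤ k * (l + 3) + 1 ∧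
      ∀ i, ∃ p, D.IsPathFromTo b (y i) (b :: p) ∧ ∀ v ∈ p, v ∈ I b ∨ v = y i) ∧
      ∀ b ∈ J, ∀ b' ∈ J, b ≠ b' → Disjoint (I b) (I b') := by
  induction J using Finset.induction_on with
  | empty => exact ⟨fun _ => ∅, by simp, by simp⟩
  | insert c J hcJ ih =>
    rw [Finset.insert_subset_iff] at hJ
    obtain ⟨I, hI, hdisj⟩ := ih hJ.2
    -- Deleting all other roots, not just those already treated, keeps fans off later roots and
    -- makes `c` of least in-degree outside `S`.
    let S := (U ∪ B.erase c) ∪ J.biUnion I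
    have hS : S.card ≤ U.card + B.card + B.card * (k * (l + 3) + 1) := by
      refine (Finset.card_union_le _ _).trans (Nat.add_le_add ?_ ?_)
      · exact (Finset.card_union_le _ _).trans (Nat.add_le_add_left Finset.card_erase_le _)
      · exact (Finset.card_biUnion_le_card_mul _ _ _ fun b hb => (hI b hb).2.2.1).trans
          (Nat.mul_le_mul_right _ (Finset.card_le_card hJ.2))
    have hcS : c ∉ S := by
      simp only [S, Finset.mem_union, Finset.mem_biUnion, not_or, not_exists, not_and]
      refine ⟨⟨Finset.disjoint_left.1 hBU hJ.1, by simp⟩, fun b hb hcb => ?_⟩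
      refine Finset.disjoint_left.1 (hI b hb).2.1 hcb (Finset.mem_union_right _ ?_)
      exact Finset.mem_erase.2 ⟨fun h' => hcJ (h' ▸ hb), hJ.1⟩
    obtain ⟨I', hcI', hI'S, hI'card, hI'⟩ := h.exists_fan hloop hl hqt (S := S) (c := c)
      (by omega) hcS
      (by
        intro v hv
        by_cases hvc : v = c
        · rw [hvc]
        · simp only [S, Finset.mem_union, Finset.mem_erase, not_or, not_and] at hv
          exact hmin c hJ.1 v (hv.1.2 hvc) hv.1.1)
      (y := y) (fun i => by simp [S, hy i])
    have hne : ∀ b ∈ J, b ≠ c := fun b hb h' => hcJ (h' ▸ hb)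
    have hI'J : ∀ b ∈ J, Disjoint I' (I b) := fun b hb => hI'S.mono_right
      ((Finset.subset_biUnion_of_mem I hb).trans Finset.subset_union_right)
    refine ⟨Function.update I c I', ?_, ?_⟩
    · intro b hb
      rcases Finset.mem_insert.1 hb with rfl | hb
      · rw [Function.update_self]
        exact ⟨hcI', hI'S.mono_right Finset.subset_union_left, hI'card, hI'⟩
      · rw [Function.update_of_ne (hne b hb)]
        exact hI b hb
    · intro b hb b' hb' hbb'
      rcases Finset.mem_insert.1 hb with rfl | hb
      · have hb' := (Finset.mem_insert.1 hb').resolve_left hbb'.symm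
        rw [Function.update_self, Function.update_of_ne (hne b' hb')]
        exact hI'J b' hb'
      · rw [Function.update_of_ne (hne b hb)]
        rcases Finset.mem_insert.1 hb' with hb' | hb'
        · rw [hb', Function.update_self]
          exact (hI'J b hb).symm
        · rw [Function.update_of_ne (hne b' hb')]
          exact hdisj b hb b' hb' hbb'

/-! ### Linking the terminals. -/

theorem theorem1p8 {V : Type*} [Fintype V] (D : Digraph V) (hloop : ∀ v : V, ¬ D.Adj v v)
    (k l : ℕ) (hk : 1 ≤ k) (hl : 2 ≤ l)
    (hstrong : D.IsStrong (81 * k ^ 2 * (l + 2) ^ 2)) (hqt : D.IsQuasiTransitive l) :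
    D.IsLinked k := by
  classical
  -- The bracket counts terminals, roots and fans; the factor `2` comes from the in-degree
  -- comparison. The left side is only linear in `l`.
  have hbound : 2 * (2 * k + k + k * (k * (l + 3) + 1)) + 2 * k < 81 * k ^ 2 * (l + 2) ^ 2 := by
    obtain ⟨k, rfl⟩ := Nat.exists_eq_add_of_le' hk
    ring_nf
    nlinarith [Nat.zero_le (k * l), Nat.zero_le (k ^ 2 * l)]
  have hV := hstrong.1
  refine ⟨by nlinarith, fun x y hx hy hxy => ?_⟩
  let X := Finset.univ.image x
  let Y := Finset.univ.image y
  have hX : X.card = k := by simp [X, Finset.card_image_of_injective _ hx]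
  have hY : Y.card = k := by simp [Y, Finset.card_image_of_injective _ hy]
  have hxX : ∀ i, x i ∈ X := fun i => Finset.mem_image_of_mem _ (Finset.mem_univ i)
  have hyY : ∀ i, y i ∈ Y := fun i => Finset.mem_image_of_mem _ (Finset.mem_univ i)
  have hXY : Disjoint X Y := by
    rw [Finset.disjoint_left]
    intro v hv hv'
    obtain ⟨i, -, rfl⟩ := Finset.mem_image.1 hv
    obtain ⟨j, -, hj⟩ := Finset.mem_image.1 hv'
    exact hxy i j hj.symm
  have hU : (X ∪ Y).card ≤ 2 * k := by
    have := Finset.card_union_le X Y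
    omega
  obtain ⟨B, hBU, hBk, hBmin⟩ := Finset.exists_subset_card_eq_of_least
    (fun v => (Finset.univ.filter (D.Adj · v)).card) (X ∪ Y)ᶜ (k := k)
    (by rw [Finset.card_compl]; omega)
  have hBU' : Disjoint B (X ∪ Y) := Finset.subset_compl_iff_disjoint_right.1 hBU
  obtain ⟨I, hI, hIdisj⟩ := hstrong.exists_fans hloop hl hqt hBU'
    (fun b hb v hvB hvU => hBmin b hb v (by simpa [hvB] using hvU)) (y := y)
    (fun i => Finset.mem_union_right _ (hyY i)) (by rw [hBk]; omega) (Finset.Subset.refl B)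
  have hIU : ∀ b ∈ B, ∀ v ∈ I b, v ∉ X ∧ v ∉ Y := fun b hb v hv => by
    have := Finset.disjoint_left.1 ((hI b hb).2.1) hv
    simp only [Finset.mem_union, not_or] at this
    exact this.1
  have hIB : ∀ b ∈ B, ∀ v ∈ I b, v ∈ B → v = b := fun b hb v hv hvB => by
    have := Finset.disjoint_left.1 ((hI b hb).2.1) hv
    by_contra hne
    exact this (Finset.mem_union_right _ (Finset.mem_erase.2 ⟨hne, hvB⟩))
  -- The roots stay available as ends of the linkage.
  let Z := Y ∪ B.biUnion fun b => (I b).erase b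
  have hZ : Z.card ≤ k + k * (k * (l + 3) + 1) := by
    refine (Finset.card_union_le _ _).trans (Nat.add_le_add hY.le ?_)
    refine (Finset.card_biUnion_le_card_mul _ _ _ fun b hb => ?_).trans_eq (by rw [hBk])
    exact Finset.card_erase_le.trans (hI b hb).2.2.1
  have hXZ : Disjoint X Z := by
    rw [Finset.disjoint_union_right, Finset.disjoint_biUnion_right]
    refine ⟨hXY, fun b hb => Finset.disjoint_right.2 fun v hv => ?_⟩
    exact (hIU b hb v (Finset.mem_of_mem_erase hv)).1
  have hBZ : Disjoint B Z := by
    rw [Finset.disjoint_union_right, Finset.disjoint_biUnion_right]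
    refine ⟨hBU'.mono_right Finset.subset_union_right,
      fun b hb => Finset.disjoint_right.2 fun v hv hvB => ?_⟩
    rw [Finset.mem_erase] at hv
    exact hv.1 (hIB b hb v hv.2 hvB)
  obtain ⟨g, P, hP, hPdisj⟩ := hstrong.exists_linkage (hX.trans hBk.symm) hXZ hBZ (by omega)
  have hg : ∀ i, g (x i) ∈ B := fun i => (hP _ (hxX i)).1
  have hgP : ∀ i, g (x i) ∈ P (x i) := fun i =>
    List.mem_of_getLast? (hP _ (hxX i)).2.1.2.2.2
  have hPdisj' : ∀ i j, i ≠ j → (P (x i)).Disjoint (P (x j)) := fun i j hij =>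
    hPdisj _ (hxX i) _ (hxX j) (hx.ne hij)
  choose q hq hqI using fun i => (hI _ (hg i)).2.2.2 i
  have hqZ : ∀ i, ∀ v ∈ q i, v ∈ Z := by
    intro i v hv
    rcases hqI i v hv with h' | h'
    · refine Finset.mem_union_right _ (Finset.mem_biUnion.2 ⟨_, hg i, Finset.mem_erase.2 ⟨?_, h'⟩⟩)
      rintro rfl
      exact (List.nodup_cons.1 (hq i).2.1).1 hv
    · exact h' ▸ Finset.mem_union_left _ (hyY i)
  have hPq : ∀ i j, (P (x i)).Disjoint (q j) := fun i j v hv hv' =>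
    (hP _ (hxX i)).2.2 v hv (hqZ j v hv')
  refine ⟨fun i => P (x i) ++ q i, fun i => (hP _ (hxX i)).2.1.append (hq i) (hPq i i), ?_⟩
  intro i j hij v hv hv'
  rw [List.mem_append] at hv hv'
  rcases hv with hv | hv <;> rcases hv' with hv' | hv'
  · exact hPdisj' i j hij hv hv'
  · exact hPq i j hv hv'
  · exact hPq j i hv' hv
  · have hgne : g (x i) ≠ g (x j) := fun h' => hPdisj' i j hij (hgP i) (h' ▸ hgP j)
    rcases hqI i v hv with h1 | h1 <;> rcases hqI j v hv' with h2 | h2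
    · exact Finset.disjoint_left.1 (hIdisj _ (hg i) _ (hg j) hgne) h1 h2
    · exact (hIU _ (hg i) v h1).2 (h2 ▸ hyY j)
    · exact (hIU _ (hg j) _ h2).2 (h1 ▸ hyY i)
    · exact hij (hy (h1.symm.trans h2))
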